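/- **Setting.** Let $H$ be a binary parity-check matrix all of whose columns have weight $d_v$ and all of whose rows have weight $d_c$ (a $(d_v,d_c)$-regular LDPC code), with $d_v\ge 3$, and let $R=\dim\{c : Hc=0\}/n$ be its rate, $n$ being the number of columns. Put $\phi(0)=1$ and $$\phi(x)=1-\frac1{\sqrt{4\pi x}}\int_{\mathbb R}\tanh\frac u2\;e^{-(u-x)^2/(4x)}\,du\qquad(x>0),$$ and let $\phi^{-1}$ be the inverse of $\phi:[0,\infty)\to(0,1]$. For $E_b/N_0>0$ let $m_\lambda=4R\,E_b/N_0$ and let the density-evolution means $m^{(l)}$ of the check-node outputs (consistent Gaussian approximation) be given by $m^{(0)}=0$ and $$m^{(l)}=\phi^{-1}\Bigl(1-\bigl[1-\phi\bigl(m_\lambda+(d_v-1)m^{(l-1)}\bigr)\bigr]^{d_c-1}\Bigr),\qquad l\ge1 .$$ The error probability at iteration $l$ is $P_e^{(l)}=\Pr\{X\le 0\}$ for $X$ Gaussian of mean $\mu_l=m_\lambda+d_v m^{(l)}$ and variance $2\mu_l$. The decoding threshold is the infimum of all $E_b/N_0>0$ for which $P_e^{(l)}\to0$ as $l\to\infty$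 (it is $+\infty$ if there are none). **Claim.** Let $E_b/N_0$ be any value above the decoding threshold. 1. For every real $r$ with $1\le r<d_v-1$ there are a constant $C>0$ and an $L$ such that $m^{(l)}>C\,r^l$ for all $l\ge L$. 2. Let $S$ be a set of at least two variable nodes (columns of $H$) such that in the subgraph of the Tanner graph of $H$ induced by $S$ and its adjacent check nodes every check node has degree one or two, at least one has degree one, and the subgraph is connected. Let $G$ be the multigraph with vertex set $S$ whose edges are the degree-two check nodes of this subgraph, and suppose that $G$ has no vertex of degree one. Let $D$ be the digraph whose vertices are the oriented edges of $G$, with an arc from an oriented edge $z$ to an oriented edge $z'$ if $z'$ starts where $z$ ends and $z,z'$ come from different edges of $G$, and let $r$ be the spectral radius of the adjacency matrix of $D$. Then $1\le r<d_v-1$, there are $C>0$ and $L$ such that $m^{(l)}>C\,r^l$ for all $l\ge L$, and moreover $m^{(l)}/r^l\to\infty$ as $l\to\infty$. -/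

import Mathlib

open Filter Topology MeasureTheory ProbabilityTheory

noncomputable section

namespace LDPC

/-! ### Density evolution under the consistent Gaussian approximation -/

/-- The function `φ`, i.e. `1 - E[tanh (U / 2)]` for `U` Gaussian of mean `x` and variance `2 x`. -/
def phi (x : ℝ) : ℝ :=
  if 0 < x then
    1 - 1 / √(4 * Real.pi * x) *
      ∫ u : ℝ, Real.tanh (u / 2) * Real.exp (-(u - x) ^ 2 / (4 * x))
  else 1

/-- The inverse of `φ : [0, ∞) → (0, 1]`. -/
def phiInv (y : ℝ) : ℝ := Function.invFunOn phi (Set.Ici 0) y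

/-- Mean of the channel log-likelihood ratios for a code of rate `R` at `E_b / N_0 = γ`
(a plain ratio, not in decibels). -/
def channelMean (R γ : ℝ) : ℝ := 4 * R * γ

/-- The mean `m^(l)` of the check node outputs at iteration `l`, for channel mean `mch`.
Iteration `0` means that no check node has sent a message yet. -/
def checkMean (dv dc : ℕ) (mch : ℝ) : ℕ → ℝ
  | 0 => 0
  | l + 1 => phiInv (1 - (1 - phi (mch + ((dv : ℝ) - 1) * checkMean dv dc mch l)) ^ (dc - 1))

/-- Mean of the soft decision of a variable node at iteration `l`: the channel value plus the
messages of all its `dv` check nodes. -/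
def decisionMean (dv dc : ℕ) (mch : ℝ) (l : ℕ) : ℝ :=
  mch + (dv : ℝ) * checkMean dv dc mch l

/-- Symbol error probability at iteration `l`: the soft decision is Gaussian with variance twice
its mean, the symbol `+1` was sent, and the decision is wrong when it is not positive. -/
def errorProb (dv dc : ℕ) (mch : ℝ) (l : ℕ) : ℝ :=
  (gaussianReal (decisionMean dv dc mch l) (Real.toNNReal (2 * decisionMean dv dc mch l))).real
    (Set.Iic 0)

/-- The decoding threshold: the infimum of the `E_b / N_0` at which the error probability tends to
zero with the number of iterations (`⊤` if there is none). -/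
def decodingThreshold (dv dc : ℕ) (R : ℝ) : EReal :=
  ⨅ γ ∈ {γ : ℝ | 0 < γ ∧
    Tendsto (errorProb dv dc (channelMean R γ)) atTop (𝓝 0)}, (γ : EReal)

/-! ### Codes, Tanner graphs and elementary trapping sets

`H` is a parity check matrix over `GF(2)`; its columns `V` are the variable nodes and its rows `C`
the check nodes. -/

section Codes

variable {V C : Type*} [Fintype V] [Fintype C] [DecidableEq V] [DecidableEq C]

/-- All variable nodes have degree `dv` and all check nodes have degree `dc`. -/
def IsRegularCode (H : Matrix C V (ZMod 2)) (dv dc : ℕ) : Prop :=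
  (∀ i : V, (Finset.univ.filter fun j : C => H j i = 1).card = dv) ∧
    ∀ j : C, (Finset.univ.filter fun i : V => H j i = 1).card = dc

/-- The rate of the code `{c | H c = 0}`: information bits per transmitted symbol. -/
def codeRate (H : Matrix C V (ZMod 2)) : ℝ :=
  (Module.finrank (ZMod 2) (LinearMap.ker H.mulVecLin) : ℝ) / (Fintype.card V : ℝ)

/-- The Tanner graph of `H`. -/
def tannerGraph (H : Matrix C V (ZMod 2)) : SimpleGraph (V ⊕ C) where
  Adj
    | Sum.inl i, Sum.inr j => H j i = 1
    | Sum.inr j, Sum.inl i => H j i = 1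
    | Sum.inl _, Sum.inl _ => False
    | Sum.inr _, Sum.inr _ => False
  symm := by
    constructor
    rintro (i | j) (i' | j') h <;> exact h
  loopless := by
    constructor
    rintro (i | j) h <;> exact h

/-- The nodes of the Tanner subgraph induced by `S`: the variable nodes of `S` and the check nodes
adjacent to them. -/
def subgraphNodes (H : Matrix C V (ZMod 2)) (S : Finset V) : Set (V ⊕ C) :=
  {x | (∃ i ∈ S, x = Sum.inl i) ∨ ∃ j : C, (∃ i ∈ S, H j i = 1) ∧ x = Sum.inr j}

/-- Degree of the check node `j` in the Tanner subgraph induced by `S`. -/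
def subDegree (H : Matrix C V (ZMod 2)) (S : Finset V) (j : C) : ℕ :=
  (S.filter fun i => H j i = 1).card

/-- Degree of `i` in the multigraph whose vertices are the elements of `S` and whose edges are the
check nodes of degree two in the Tanner subgraph induced by `S`. -/
def multigraphDegree (H : Matrix C V (ZMod 2)) (S : Finset V) (i : V) : ℕ :=
  (Finset.univ.filter fun j : C => H j i = 1 ∧ subDegree H S j = 2).card

/-- `S` is a potential non-codeword elementary trapping set: it has at least two variable nodes,
every check node of its Tanner subgraph has degree one or two, at least one has degree one, the
Tanner subgraph is connected, and the associated multigraph has no leaf. -/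
structure IsElementaryTrappingSet (H : Matrix C V (ZMod 2)) (S : Finset V) : Prop where
  two_le_card : 2 ≤ S.card
  elementary : ∀ j : C, (∃ i ∈ S, H j i = 1) → subDegree H S j = 1 ∨ subDegree H S j = 2
  exists_degree_one : 0 < (Finset.univ.filter fun j : C => subDegree H S j = 1).card
  connected : ((tannerGraph H).induce (subgraphNodes H S)).Connected
  leafless : ∀ i ∈ S, multigraphDegree H S i ≠ 1

/-- The vertices of the digraph `D` of message flow: the edges `(i, j)` between a variable node `i`
of `S` and a check node `j` of degree two in the subgraph. Such an edge stands for the edge `j` of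
the multigraph, oriented away from `i`. -/
abbrev State (H : Matrix C V (ZMod 2)) (S : Finset V) : Type _ :=
  {z : V × C // z.1 ∈ S ∧ H z.2 z.1 = 1 ∧ subDegree H S z.2 = 2}

/-- The adjacency matrix of `D`: there is an arc from `(i, j)` to `(i', j')` if `i'` is the other
end of `j` and `j'` is a different edge of the multigraph. -/
def stateMatrix (H : Matrix C V (ZMod 2)) (S : Finset V) :
    Matrix (State H S) (State H S) ℂ :=
  Matrix.of fun z z' =>
    if H z.1.2 z'.1.1 = 1 ∧ z'.1.1 ≠ z.1.1 ∧ z'.1.2 ≠ z.1.2 then 1 else 0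

/-- The spectral radius of the adjacency matrix of `D`. -/
def trappingRadius (H : Matrix C V (ZMod 2)) (S : Finset V) : ℝ :=
  (spectralRadius ℂ (stateMatrix H S)).toReal

end Codes

end LDPC

end

/-! Growth. Since `e^(-(u-x)²/(4x)) e^(-u/2) = e^(-x/4) e^(-u²/(4x))`, `φ` is `e^(-x/4)` times the
decreasing factor `sechMean`, so `φ(y) ≤ e^(-(y-x)/4) φ(x)` for `0 ≤ x ≤ y`. With Bernoulli's
inequality, a check mean `c` has a successor `c'` with `φ(c') ≤ (dc-1) e^(-(dv-1-r)c/4) φ(rc)`. Once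
`c` is large this is at most `φ(rc)`, so `c' ≥ rc` (`exists_forall_mul_le_checkMean_succ`). Above
the threshold the means do become large: vanishing error at some smaller `E_b/N_0` forces them to
infinity there, and they increase with `E_b/N_0`.

Spectral radius. Leaflessness gives every state a successor, whence `1 ≤ r`. All degrees of `D` are
at most `dv-1`. If `r ≥ dv-1`, the coordinates of maximal modulus of an eigenvector form a set
closed under successors and predecessors with all out-degrees `dv-1`
(`exists_closed_of_le_spectralRadius`). By connectedness every vertex of `S` then has `dv` edges in
the multigraph, leaving no room for a check node of degree one.

The ratio `m^(l)/r^l` diverges because the growth bound also holds for some `s` strictly between `r`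
and `dv-1`. -/

namespace LDPC

/-! ### The function `φ` -/

/-- The mean of `1 / cosh (U / 2)` for `U` Gaussian of mean `0` and variance `2 x`. -/
noncomputable def sechMean (x : ℝ) : ℝ :=
  ∫ z, (Real.cosh (√(x / 2) * z))⁻¹ ∂gaussianReal 0 1

lemma integrable_inv_cosh (a : ℝ) (μ : Measure ℝ) [IsFiniteMeasure μ] :
    Integrable (fun z => (Real.cosh (a * z))⁻¹) μ := by
  refine Integrable.of_bound (C := 1) ?_ (ae_of_all _ fun z => ?_)
  · exact ((Real.continuous_cosh.comp (continuous_const.mul continuous_id)).inv₀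
      fun z => (Real.cosh_pos _).ne').aestronglyMeasurable
  · rw [Real.norm_of_nonneg (inv_nonneg.2 (Real.cosh_pos _).le)]
    exact inv_le_one_of_one_le₀ (Real.one_le_cosh _)

lemma sechMean_pos (x : ℝ) : 0 < sechMean x := by
  refine (integral_pos_iff_support_of_nonneg (fun z => ?_) (integrable_inv_cosh _ _)).2 ?_
  · exact inv_nonneg.2 (Real.cosh_pos _).le
  · have : Function.support (fun z => (Real.cosh (√(x / 2) * z))⁻¹) = Set.univ := by
      ext z
      simpa only [Function.mem_support, Set.mem_univ, iff_true] using
        inv_ne_zero (Real.cosh_pos (√(x / 2) * z)).ne'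
    rw [this]
    simp

lemma sechMean_antitone : Antitone sechMean := by
  intro x y hxy
  refine integral_mono (integrable_inv_cosh _ _) (integrable_inv_cosh _ _) fun z => ?_
  refine inv_anti₀ (Real.cosh_pos _) (Real.cosh_le_cosh.2 ?_)
  rw [abs_mul, abs_mul, abs_of_nonneg (Real.sqrt_nonneg _), abs_of_nonneg (Real.sqrt_nonneg _)]
  gcongr

lemma sechMean_zero : sechMean 0 = 1 := by
  simp [sechMean]

lemma continuous_sechMean : Continuous sechMean := by
  refine continuous_of_dominated (bound := fun _ => 1) (fun x => ?_) (fun x => ?_)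
    (integrable_const _) ?_
  · exact (integrable_inv_cosh _ _).aestronglyMeasurable
  · refine ae_of_all _ fun z => ?_
    rw [Real.norm_of_nonneg (inv_nonneg.2 (Real.cosh_pos _).le)]
    exact inv_le_one_of_one_le₀ (Real.one_le_cosh _)
  · refine ae_of_all _ fun z => ?_
    refine Continuous.inv₀ ?_ fun x => (Real.cosh_pos _).ne'
    exact Real.continuous_cosh.comp (by fun_prop)

lemma sechMean_eq_integral {x : ℝ} (hx : 0 < x) :
    sechMean x = ∫ u, (Real.cosh (u / 2))⁻¹ ∂gaussianReal 0 (2 * x).toNNReal := by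
  have hmap : (gaussianReal 0 1).map (√(2 * x) * ·) = gaussianReal 0 (2 * x).toNNReal := by
    rw [gaussianReal_map_const_mul]
    congr 1
    · simp
    · ext
      have hx2 : 0 ≤ 2 * x := by positivity
      rw [mul_one, NNReal.coe_mk, Real.sq_sqrt hx2, Real.coe_toNNReal _ hx2]
  have hs : √(x / 2) = √(2 * x) / 2 := by
    rw [show x / 2 = 2 * x / 2 ^ 2 by ring, Real.sqrt_div (by positivity),
      Real.sqrt_sq (by norm_num)]
  rw [← hmap, integral_map (by fun_prop)]
  · unfold sechMean
    refine integral_congr_ae (ae_of_all _ fun z => ?_)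
    simp only [hs]
    ring_nf
  · have := (integrable_inv_cosh (1 / 2) ((gaussianReal 0 1).map (√(2 * x) * ·))).1
    simpa [div_eq_inv_mul] using this

lemma one_sub_tanh (u : ℝ) : 1 - Real.tanh u = Real.exp (-u) * (Real.cosh u)⁻¹ := by
  have := (Real.cosh_pos u).ne'
  rw [Real.tanh_eq_sinh_div_cosh, ← Real.cosh_sub_sinh]
  field_simp

/-- Completing the square: the factor `e^(-u/2)` of `1 - tanh(u/2)` shifts the Gaussian from mean
`x` to mean `0` at the cost of `e^(-x/4)`. -/
lemma phi_eq {x : ℝ} (hx : 0 ≤ x) : phi x = Real.exp (-x / 4) * sechMean x := by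
  rcases hx.eq_or_lt with rfl | hx
  · simp [phi, sechMean_zero]
  have hv : (2 * x).toNNReal ≠ 0 := by simpa using hx
  have hvx : (((2 * x).toNNReal : NNReal) : ℝ) = 2 * x := Real.coe_toNNReal _ (by positivity)
  have htanh : Integrable (fun u => Real.tanh (u / 2)) (gaussianReal x (2 * x).toNNReal) := by
    refine Integrable.of_bound (C := 1) ?_ (ae_of_all _ fun u => ?_)
    · have : Continuous fun u : ℝ => Real.sinh (u / 2) / Real.cosh (u / 2) :=
        (Real.continuous_sinh.comp (by fun_prop)).div (Real.continuous_cosh.comp (by fun_prop))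
          fun z => (Real.cosh_pos _).ne'
      simpa only [Real.tanh_eq_sinh_div_cosh] using this.aestronglyMeasurable
    · rw [Real.norm_eq_abs, abs_le]
      exact ⟨(Real.neg_one_lt_tanh _).le, (Real.tanh_lt_one _).le⟩
  have h1 : phi x = ∫ u, (1 - Real.tanh (u / 2)) ∂gaussianReal x (2 * x).toNNReal := by
    rw [integral_sub (integrable_const _) htanh, phi, if_pos hx, ← integral_const_mul]
    congr 1
    · simp
    · rw [integral_gaussianReal_eq_integral_smul hv]
      refine integral_congr_ae (ae_of_all _ fun u => ?_)
      simp only [gaussianPDFReal, smul_eq_mul, hvx]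
      rw [show 2 * Real.pi * (2 * x) = 4 * Real.pi * x by ring,
        show 2 * (2 * x) = 4 * x by ring]
      ring
  rw [h1, sechMean_eq_integral hx, integral_gaussianReal_eq_integral_smul hv,
    integral_gaussianReal_eq_integral_smul hv, ← integral_const_mul]
  refine integral_congr_ae (ae_of_all _ fun u => ?_)
  simp only [gaussianPDFReal, smul_eq_mul, hvx, one_sub_tanh]
  have : Real.exp (-(u - x) ^ 2 / (2 * (2 * x))) * Real.exp (-(u / 2)) =
      Real.exp (-x / 4) * Real.exp (-(u - 0) ^ 2 / (2 * (2 * x))) := by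
    rw [← Real.exp_add, ← Real.exp_add]
    congr 1
    field_simp
    ring
  linear_combination (√(2 * Real.pi * (2 * x)))⁻¹ * (Real.cosh (u / 2))⁻¹ * this

lemma phi_pos {x : ℝ} (hx : 0 ≤ x) : 0 < phi x := by
  rw [phi_eq hx]
  exact mul_pos (Real.exp_pos _) (sechMean_pos x)

lemma phi_zero : phi 0 = 1 := by simp [phi]

/-- `φ` decays at least as fast as `e^(-x/4)`. -/
lemma phi_le_exp_mul_phi {x y : ℝ} (hx : 0 ≤ x) (hxy : x ≤ y) :
    phi y ≤ Real.exp (-(y - x) / 4) * phi x := by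
  rw [phi_eq hx, phi_eq (hx.trans hxy), ← mul_assoc, ← Real.exp_add,
    show -(y - x) / 4 + -x / 4 = -y / 4 by ring]
  exact mul_le_mul_of_nonneg_left (sechMean_antitone hxy) (Real.exp_pos _).le

lemma phi_strictAntiOn : StrictAntiOn phi (Set.Ici 0) := by
  intro x hx y _ hxy
  refine (phi_le_exp_mul_phi hx hxy.le).trans_lt ?_
  refine mul_lt_of_lt_one_left (phi_pos hx) ?_
  rw [← Real.exp_zero, Real.exp_lt_exp]
  linarith

lemma phi_le_one {x : ℝ} (hx : 0 ≤ x) : phi x ≤ 1 := by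
  rw [← phi_zero]
  exact phi_strictAntiOn.antitoneOn Set.self_mem_Ici hx hx

lemma phi_surjOn : Set.SurjOn phi (Set.Ici 0) (Set.Ioc 0 1) := by
  rintro y ⟨hy0, hy1⟩
  -- As `φ(x) ≤ e^(-x/4)`, the value `y` is reached no later than `x = -4 log y`.
  have hlog : 0 ≤ -4 * Real.log y := by
    have := Real.log_nonpos hy0.le hy1
    linarith
  have hle : phi (-4 * Real.log y) ≤ y := by
    have := phi_le_exp_mul_phi le_rfl hlog
    rwa [phi_zero, mul_one, show -(-4 * Real.log y - 0) / 4 = Real.log y by ring,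
      Real.exp_log hy0] at this
  have hcont : ContinuousOn phi (Set.Icc 0 (-4 * Real.log y)) := by
    have : Continuous fun x : ℝ => Real.exp (-x / 4) * sechMean x :=
      (by fun_prop : Continuous fun x : ℝ => Real.exp (-x / 4)).mul continuous_sechMean
    exact this.continuousOn.congr fun x hx => phi_eq hx.1
  obtain ⟨x, hx, hxy⟩ := intermediate_value_Icc' hlog hcont ⟨hle, by rwa [phi_zero]⟩
  exact ⟨x, hx.1, hxy⟩

lemma phiInv_nonneg {y : ℝ} (hy : y ∈ Set.Ioc (0 : ℝ) 1) : 0 ≤ phiInv y :=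
  Function.invFunOn_mem (phi_surjOn hy)

lemma phi_phiInv {y : ℝ} (hy : y ∈ Set.Ioc (0 : ℝ) 1) : phi (phiInv y) = y :=
  Function.invFunOn_eq (phi_surjOn hy)

lemma le_phiInv {x y : ℝ} (hx : 0 ≤ x) (hy : y ∈ Set.Ioc (0 : ℝ) 1) (h : y ≤ phi x) :
    x ≤ phiInv y := by
  rw [← phi_phiInv hy] at h
  exact (phi_strictAntiOn.le_iff_ge (phiInv_nonneg hy) hx).1 h

lemma phiInv_anti {y y' : ℝ} (hy : y ∈ Set.Ioc (0 : ℝ) 1) (hy' : y' ∈ Set.Ioc (0 : ℝ) 1)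
    (h : y ≤ y') : phiInv y' ≤ phiInv y :=
  le_phiInv (phiInv_nonneg hy') hy (by rwa [phi_phiInv hy'])

/-! ### Density evolution -/

lemma one_sub_one_sub_pow_mem {t : ℝ} (h0 : 0 < t) (h1 : t ≤ 1) {n : ℕ} (hn : n ≠ 0) :
    1 - (1 - t) ^ n ∈ Set.Ioc (0 : ℝ) 1 := by
  have hp : (1 - t) ^ n < 1 := pow_lt_one₀ (by linarith) (by linarith) hn
  have hq : 0 ≤ (1 - t) ^ n := pow_nonneg (by linarith) n
  exact ⟨by linarith, by linarith⟩

lemma checkMean_nonneg {dv dc : ℕ} (hdv : 1 ≤ dv) (hdc : 2 ≤ dc) {mch : ℝ} (hm : 0 ≤ mch)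
    (l : ℕ) : 0 ≤ checkMean dv dc mch l := by
  induction l with
  | zero => exact le_rfl
  | succ l ih =>
    have hd : (0 : ℝ) ≤ (dv : ℝ) - 1 := by
      have : (1 : ℝ) ≤ dv := by exact_mod_cast hdv
      linarith
    have hx : 0 ≤ mch + ((dv : ℝ) - 1) * checkMean dv dc mch l := by positivity
    exact phiInv_nonneg (one_sub_one_sub_pow_mem (phi_pos hx) (phi_le_one hx) (by omega))

/-- Each iteration composes two decreasing maps, `φ` and its inverse, with the increasing `t ↦ 1 -
(1-t)^(dc-1)`. -/
lemma checkMean_mono {dv dc : ℕ} (hdv : 1 ≤ dv) (hdc : 2 ≤ dc) {a b : ℝ} (ha : 0 ≤ a)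
    (hab : a ≤ b) (l : ℕ) : checkMean dv dc a l ≤ checkMean dv dc b l := by
  induction l with
  | zero => exact le_rfl
  | succ l ih =>
    have hd : (0 : ℝ) ≤ (dv : ℝ) - 1 := by
      have : (1 : ℝ) ≤ dv := by exact_mod_cast hdv
      linarith
    have ha' := checkMean_nonneg hdv hdc ha l
    have hb' := checkMean_nonneg hdv hdc (ha.trans hab) l
    have hx : 0 ≤ a + ((dv : ℝ) - 1) * checkMean dv dc a l := by positivity
    have hy : a + ((dv : ℝ) - 1) * checkMean dv dc a l ≤
      b + ((dv : ℝ) - 1) * checkMean dv dc b l := by gcongr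
    have hφ := phi_strictAntiOn.antitoneOn hx (hx.trans hy) hy
    refine phiInv_anti
      (one_sub_one_sub_pow_mem (phi_pos (hx.trans hy)) (phi_le_one (hx.trans hy)) (by omega))
      (one_sub_one_sub_pow_mem (phi_pos hx) (phi_le_one hx) (by omega)) ?_
    have h1 := phi_le_one hx
    gcongr

/-- Once the check node means are large, each iteration multiplies them by `r`. -/
lemma exists_forall_mul_le_checkMean_succ {dv dc : ℕ} (hdv : 1 ≤ dv) (hdc : 2 ≤ dc) {mch : ℝ}
    (hm : 0 ≤ mch) {r : ℝ} (hr0 : 0 ≤ r) (hr : r < (dv : ℝ) - 1) :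
    ∃ B : ℝ, ∀ l, B ≤ checkMean dv dc mch l →
      r * checkMean dv dc mch l ≤ checkMean dv dc mch (l + 1) := by
  have hq : 0 < (dv : ℝ) - 1 - r := by linarith
  have hn : (0 : ℝ) < ((dc - 1 : ℕ) : ℝ) := by
    exact_mod_cast (by omega : 0 < dc - 1)
  -- The bound beyond which `(dc-1) e^(-(dv-1-r)c/4) ≤ 1`.
  refine ⟨4 * Real.log ((dc - 1 : ℕ) : ℝ) / ((dv : ℝ) - 1 - r), fun l hl => ?_⟩
  have hc := checkMean_nonneg hdv hdc hm l
  set c := checkMean dv dc mch l with hcdef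
  have hrc : 0 ≤ r * c := by positivity
  have hle : r * c ≤ mch + ((dv : ℝ) - 1) * c := by nlinarith
  have hx : 0 ≤ mch + ((dv : ℝ) - 1) * c := hrc.trans hle
  refine le_phiInv hrc
    (one_sub_one_sub_pow_mem (phi_pos hx) (phi_le_one hx) (by omega)) ?_
  rw [← hcdef]
  have hbern := one_add_mul_le_pow (a := -phi (mch + ((dv : ℝ) - 1) * c))
    (by linarith [phi_le_one hx]) (dc - 1)
  rw [← sub_eq_add_neg] at hbern
  have hdecay := phi_le_exp_mul_phi hrc hle
  have hexp : ((dc - 1 : ℕ) : ℝ) *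
      Real.exp (-(mch + ((dv : ℝ) - 1) * c - r * c) / 4) ≤ 1 := by
    rw [div_le_iff₀ hq] at hl
    calc ((dc - 1 : ℕ) : ℝ) * Real.exp (-(mch + ((dv : ℝ) - 1) * c - r * c) / 4)
        ≤ ((dc - 1 : ℕ) : ℝ) * Real.exp (-Real.log ((dc - 1 : ℕ) : ℝ)) := by
          gcongr
          nlinarith
      _ = 1 := by rw [Real.exp_neg, Real.exp_log hn, mul_inv_cancel₀ hn.ne']
  have := mul_le_mul_of_nonneg_left hdecay hn.le
  have := mul_le_mul_of_nonneg_right hexp (phi_pos hrc).le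
  nlinarith

lemma exists_mul_pow_lt_checkMean {dv dc : ℕ} (hdv : 1 ≤ dv) (hdc : 2 ≤ dc) {mch : ℝ}
    (hm : 0 ≤ mch) (hlim : Tendsto (checkMean dv dc mch) atTop atTop) {r : ℝ} (hr1 : 0 < r)
    (hr : r < (dv : ℝ) - 1) :
    ∃ K : ℝ, 0 < K ∧ ∃ L : ℕ, ∀ l, L ≤ l → K * r ^ l < checkMean dv dc mch l := by
  obtain ⟨B, hB⟩ := exists_forall_mul_le_checkMean_succ hdv hdc hm hr1.le hr
  obtain ⟨L, hL⟩ := eventually_atTop.1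
    ((hlim.eventually_ge_atTop B).and (hlim.eventually_gt_atTop 0))
  have hpos := (hL L le_rfl).2
  have hrL : 0 < r ^ L := by positivity
  -- The factor `2` makes the inequality strict at `l = L`.
  refine ⟨checkMean dv dc mch L / (2 * r ^ L), by positivity, L, fun l hl => ?_⟩
  have key : checkMean dv dc mch L / (2 * r ^ L) * r ^ L < checkMean dv dc mch L := by
    rw [show checkMean dv dc mch L / (2 * r ^ L) * r ^ L = checkMean dv dc mch L / 2 by field_simp]
    linarith
  induction l, hl using Nat.le_induction with
  | base => exact key
  | succ l hl ih =>
    refine lt_of_lt_of_le ?_ (hB l (hL l hl).1)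
    rw [pow_succ]
    nlinarith

/-- The error probability of a soft decision decreases with its mean. -/
lemma le_errorProb_of_decisionMean_le {dv dc : ℕ} {mch M : ℝ} {l : ℕ}
    (hM : decisionMean dv dc mch l ≤ M) :
    (gaussianReal 0 1).real (Set.Iic (-√(M / 2))) ≤ errorProb dv dc mch l := by
  unfold errorProb
  set m := decisionMean dv dc mch l
  rcases le_or_gt m 0 with hm | hm
  -- The variance truncates to zero: a point mass at `m ≤ 0`, with error probability one.
  · rw [Real.toNNReal_of_nonpos (by linarith), gaussianReal_zero_var]
    simp [measureReal_def, hm]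
    exact (ENNReal.toReal_mono ENNReal.one_ne_top prob_le_one).trans_eq ENNReal.toReal_one
  have hmap : gaussianReal m (2 * m).toNNReal =
      ((gaussianReal 0 1).map (√(2 * m) * ·)).map (· + m) := by
    rw [gaussianReal_map_const_mul, gaussianReal_map_add_const]
    congr 1
    · simp
    · ext
      have hm2 : 0 ≤ 2 * m := by positivity
      rw [mul_one, NNReal.coe_mk, Real.sq_sqrt hm2, Real.coe_toNNReal _ hm2]
  rw [hmap, map_measureReal_apply (by fun_prop) measurableSet_Iic,
    map_measureReal_apply (by fun_prop) (measurableSet_Iic.preimage (by fun_prop))]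
  refine measureReal_mono fun z hz => ?_
  simp only [Set.mem_preimage, Set.mem_Iic] at hz ⊢
  -- The decision is `√(2m) Z + m` with `Z` standard, hence wrong exactly when `Z ≤ -√(m/2)`.
  have hs : √(2 * m) * √(m / 2) = m := by
    rw [← Real.sqrt_mul (by positivity), show 2 * m * (m / 2) = m ^ 2 by ring, Real.sqrt_sq hm.le]
  have : z ≤ -√(m / 2) := hz.trans (neg_le_neg (Real.sqrt_le_sqrt (by linarith)))
  have := mul_le_mul_of_nonneg_left this (Real.sqrt_nonneg (2 * m))
  linarith

lemma gaussianReal_Iic_pos (a : ℝ) : 0 < (gaussianReal 0 1).real (Set.Iic a) := by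
  refine ENNReal.toReal_pos (fun h => ?_) (measure_ne_top _ _)
  have := gaussianReal_absolutelyContinuous' 0 one_ne_zero h
  simp at this

lemma tendsto_decisionMean {dv dc : ℕ} {mch : ℝ}
    (h : Tendsto (errorProb dv dc mch) atTop (𝓝 0)) :
    Tendsto (decisionMean dv dc mch) atTop atTop := by
  refine tendsto_atTop.2 fun M => ?_
  filter_upwards [h.eventually_lt_const (gaussianReal_Iic_pos (-√(M / 2)))] with l hl
  by_contra! hlt
  exact absurd hl (not_lt.2 (le_errorProb_of_decisionMean_le hlt.le))

lemma tendsto_checkMean {dv dc : ℕ} (hdv : 1 ≤ dv) {mch : ℝ}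
    (h : Tendsto (errorProb dv dc mch) atTop (𝓝 0)) :
    Tendsto (checkMean dv dc mch) atTop atTop := by
  have hd : (0 : ℝ) < dv := by exact_mod_cast hdv
  have := (tendsto_atTop_add_const_left atTop (-mch) (tendsto_decisionMean h)).atTop_div_const hd
  refine this.congr fun l => ?_
  unfold decisionMean
  field_simp
  ring

/-- If the error probability tends to zero then the check nodes have degree at least two. -/
lemma two_le_of_tendsto_errorProb {dv dc : ℕ} (hdv : 1 ≤ dv) {mch : ℝ}
    (h : Tendsto (errorProb dv dc mch) atTop (𝓝 0)) : 2 ≤ dc := by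
  by_contra! hdc
  -- For `dc ≤ 1` the exponent `dc - 1` is zero, so the means are stuck at the default value `phiInv
  -- 0`.
  have hconst : ∀ l, checkMean dv dc mch (l + 1) = phiInv 0 := fun l => by
    simp [checkMean, show dc - 1 = 0 by omega]
  have := (tendsto_checkMean hdv h).comp (tendsto_add_atTop_nat 1)
  rw [show checkMean dv dc mch ∘ (· + 1) = fun _ => phiInv 0 from funext hconst] at this
  exact not_tendsto_const_atTop _ _ this

/-- Above the decoding threshold the means of the check node outputs tend to infinity. -/
lemma tendsto_checkMean_of_threshold_lt {dv dc : ℕ} (hdv : 1 ≤ dv) {R γ : ℝ} (hR : 0 ≤ R)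
    (hγ : decodingThreshold dv dc R < (γ : EReal)) :
    2 ≤ dc ∧ 0 ≤ channelMean R γ ∧
      Tendsto (checkMean dv dc (channelMean R γ)) atTop atTop := by
  unfold decodingThreshold at hγ
  simp only [iInf_lt_iff] at hγ
  obtain ⟨γ₀, ⟨hγ₀, h⟩, hlt⟩ := hγ
  have hlt : γ₀ < γ := EReal.coe_lt_coe_iff.1 hlt
  have hdc := two_le_of_tendsto_errorProb hdv h
  have h0 : 0 ≤ channelMean R γ₀ := by unfold channelMean; positivity
  have hle : channelMean R γ₀ ≤ channelMean R γ := by unfold channelMean; gcongr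
  exact ⟨hdc, h0.trans hle,
    tendsto_atTop_mono (checkMean_mono hdv hdc h0 hle) (tendsto_checkMean hdv h)⟩

lemma codeRate_nonneg {V C : Type*} [Fintype V] [Fintype C] [DecidableEq V] [DecidableEq C]
    (H : Matrix C V (ZMod 2)) : 0 ≤ codeRate H := by
  unfold codeRate
  positivity

/-! ### Spectral radii of adjacency matrices of digraphs -/

section Digraph

variable {σ : Type*} [Fintype σ] (E : σ → σ → Prop) [DecidableRel E]

/-- The adjacency matrix of the relation `E`. -/
def relMatrix : Matrix σ σ ℂ := Matrix.of fun z z' => if E z z' then 1 else 0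

lemma relMatrix_mulVec (x : σ → ℂ) (z : σ) :
    (relMatrix E).mulVec x z = ∑ z' with E z z', x z' := by
  simp [relMatrix, Matrix.mulVec, dotProduct, Finset.sum_filter]

attribute [local instance] Matrix.linftyOpNormedRing Matrix.linftyOpNormedAlgebra

lemma spectralRadius_ne_top {ι : Type*} [Fintype ι] [DecidableEq ι] [Nonempty ι]
    (A : Matrix ι ι ℂ) : spectralRadius ℂ A ≠ ⊤ := by
  obtain ⟨k, -, hk⟩ := spectrum.exists_nnnorm_eq_spectralRadius A
  exact hk ▸ ENNReal.coe_ne_top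

/-- A digraph all of whose vertices have a successor has spectral radius at least one. -/
lemma one_le_spectralRadius_relMatrix [DecidableEq σ] [Nonempty σ] (hE : ∀ z, ∃ z', E z z') :
    1 ≤ (spectralRadius ℂ (relMatrix E)).toReal := by
  have hpow : ∀ n : ℕ, ∃ w : σ → ℝ, (∀ z, 1 ≤ w z) ∧
      ((relMatrix E) ^ n).mulVec 1 = fun z => (w z : ℂ) := by
    intro n
    induction n with
    | zero => exact ⟨1, fun _ => le_rfl, by ext; simp⟩
    | succ n ih =>
      obtain ⟨w, hw, h⟩ := ih
      refine ⟨fun z => ∑ z' with E z z', w z', fun z => ?_, ?_⟩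
      · obtain ⟨z', hz'⟩ := hE z
        refine (hw z').trans (Finset.single_le_sum (f := w) (fun i _ => ?_) ?_)
        · exact zero_le_one.trans (hw i)
        · simpa using hz'
      · rw [pow_succ', ← Matrix.mulVec_mulVec, h]
        ext z
        rw [relMatrix_mulVec]
        simp
  -- The all-ones vector has norm one and its image under the `n`-th power has entries at least one;
  -- Gelfand's formula then applies.
  have hnorm : ∀ n : ℕ, 1 ≤ ‖(relMatrix E) ^ n‖₊ := by
    intro n
    obtain ⟨w, hw, h⟩ := hpow n
    have z : σ := Classical.arbitrary σ
    have h1 := Matrix.linfty_opNNNorm_mulVec ((relMatrix E) ^ n) (1 : σ → ℂ)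
    rw [nnnorm_one, mul_one] at h1
    refine le_trans ?_ ((nnnorm_le_pi_nnnorm _ z).trans h1)
    rw [h, ← NNReal.coe_le_coe]
    simpa using (hw z).trans (le_abs_self _)
  have hlim := spectrum.pow_nnnorm_pow_one_div_tendsto_nhds_spectralRadius (relMatrix E)
  have : 1 ≤ spectralRadius ℂ (relMatrix E) := by
    refine ge_of_tendsto hlim ((eventually_gt_atTop 0).mono fun n hn => ?_)
    exact ENNReal.one_le_rpow (by exact_mod_cast hnorm n) (by positivity)
  exact (ENNReal.toReal_le_toReal ENNReal.one_ne_top (spectralRadius_ne_top _)).2 this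

/-- In a digraph with out- and in-degrees at most `d`, the spectral radius is below `d` unless some
nonempty set of vertices of out-degree `d` is closed under successors and predecessors. -/
lemma exists_closed_of_le_spectralRadius [DecidableEq σ] [Nonempty σ] {d : ℕ}
    (hout : ∀ z, (Finset.univ.filter fun z' => E z z').card ≤ d)
    (hin : ∀ z', (Finset.univ.filter fun z => E z z').card ≤ d)
    (hr : (d : ℝ) ≤ (spectralRadius ℂ (relMatrix E)).toReal) :
    ∃ P : Finset σ, P.Nonempty ∧
      (∀ z ∈ P, (Finset.univ.filter fun z' => E z z').card = d) ∧
      ∀ z z', E z z' → (z ∈ P ↔ z' ∈ P) := by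
  obtain ⟨k, hk, hkr⟩ := spectrum.exists_nnnorm_eq_spectralRadius (relMatrix E)
  have hdk : (d : ℝ) ≤ ‖k‖ := by
    rw [← hkr] at hr
    simpa using hr
  rw [← Matrix.spectrum_toLin', ← Module.End.hasEigenvalue_iff_mem_spectrum] at hk
  obtain ⟨x, hx⟩ := hk.exists_hasEigenvector
  have hx0 := hx.2
  have hxk : ∀ z, ∑ z' with E z z', x z' = k * x z := fun z => by
    have := congrFun hx.apply_eq_smul z
    rwa [Matrix.toLin'_apply, relMatrix_mulVec] at this
  obtain ⟨z₀, hz₀⟩ := Finite.exists_max fun z => ‖x z‖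
  have hpos : 0 < ‖x z₀‖ := by
    obtain ⟨z, hz⟩ := Function.ne_iff.1 hx0
    exact (norm_pos_iff.2 hz).trans_le (hz₀ z)
  set M := ‖x z₀‖
  -- Together with `hup` and `hout` this forces equality: `d` successors, all of modulus `M`.
  have hlow : ∀ z, ‖x z‖ = M → d * M ≤ ∑ z' with E z z', ‖x z'‖ := fun z hz => by
    calc d * M ≤ ‖k‖ * M := by gcongr
      _ = ‖∑ z' with E z z', x z'‖ := by rw [hxk, norm_mul, hz]
      _ ≤ _ := norm_sum_le _ _
  have hup : ∀ z, ∑ z' with E z z', ‖x z'‖ ≤ ∑ z' with E z z', M :=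
    fun z => Finset.sum_le_sum fun z' _ => hz₀ z'
  have hcard : ∀ z, ‖x z‖ = M → (Finset.univ.filter fun z' => E z z').card = d := fun z hz => by
    refine le_antisymm (hout z) ?_
    have := (hlow z hz).trans (hup z)
    rw [Finset.sum_const, nsmul_eq_mul] at this
    exact_mod_cast le_of_mul_le_mul_right this hpos
  have hsucc : ∀ z z', E z z' → ‖x z‖ = M → ‖x z'‖ = M := fun z z' hzz' hz => by
    have heq : ∑ z' with E z z', ‖x z'‖ = ∑ z' with E z z', M := by
      refine le_antisymm (hup z) ((hlow z hz).trans' ?_)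
      rw [Finset.sum_const, nsmul_eq_mul, hcard z hz]
    exact (Finset.sum_eq_sum_iff_of_le fun z' _ => hz₀ z').1 heq z' (by simpa using hzz')
  let P : Finset σ := Finset.univ.filter fun z => ‖x z‖ = M
  have hP : ∀ z, z ∈ P ↔ ‖x z‖ = M := fun z => by simp [P]
  refine ⟨P, ⟨z₀, (hP _).2 rfl⟩, fun z hz => hcard z ((hP z).1 hz), fun z z' hzz' =>
    ⟨fun hz => (hP _).2 (hsucc z z' hzz' ((hP z).1 hz)), fun hz' => ?_⟩⟩
  have hle : ∀ z' ∈ P, (P.filter fun z => E z z').card ≤ d := fun z' _ =>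
    (Finset.card_le_card (Finset.filter_subset_filter _ (Finset.subset_univ _))).trans (hin z')
  -- All `d * |P|` arcs leaving `P` end in `P`, where each vertex receives at most `d`. So each
  -- receives exactly `d` from `P` and none from outside.
  have hdouble : ∑ z' ∈ P, (P.filter fun z => E z z').card = ∑ z' ∈ P, d := by
    refine (Finset.sum_card_bipartiteAbove_eq_sum_card_bipartiteBelow E).symm.trans ?_
    refine Finset.sum_congr rfl fun z hz => ?_
    rw [← hcard z ((hP z).1 hz)]
    congr 1
    ext y
    simp only [Finset.mem_bipartiteAbove, Finset.mem_filter, Finset.mem_univ, true_and]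
    exact ⟨fun h => h.2, fun h => ⟨(hP _).2 (hsucc z y h ((hP z).1 hz)), h⟩⟩
  have hfull := (Finset.sum_eq_sum_iff_of_le hle).1 hdouble z' hz'
  have hsub : (P.filter fun z => E z z') = Finset.univ.filter fun z => E z z' :=
    Finset.eq_of_subset_of_card_le (Finset.filter_subset_filter _ (Finset.subset_univ _))
      (hfull ▸ hin z')
  have : z ∈ P.filter fun z => E z z' := hsub ▸ (by simpa using hzz')
  exact (Finset.mem_filter.1 this).1

end Digraph

/-! ### The digraph of message flow in an elementary trapping set -/

section TrappingSets

set_option linter.unusedSectionVars false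

variable {V C : Type*} [Fintype V] [Fintype C] [DecidableEq V] [DecidableEq C]
  {H : Matrix C V (ZMod 2)} {S : Finset V}

/-- The arcs of the digraph `D` of message flow. -/
abbrev Arc (H : Matrix C V (ZMod 2)) (S : Finset V) (z z' : State H S) : Prop :=
  H z.1.2 z'.1.1 = 1 ∧ z'.1.1 ≠ z.1.1 ∧ z'.1.2 ≠ z.1.2

lemma stateMatrix_eq_relMatrix : stateMatrix H S = relMatrix (Arc H S) := rfl

/-- The edges of the multigraph at the vertex `i`. -/
abbrev edgesAt (H : Matrix C V (ZMod 2)) (S : Finset V) (i : V) : Finset C :=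
  Finset.univ.filter fun j => H j i = 1 ∧ subDegree H S j = 2

lemma card_edgesAt (i : V) : (edgesAt H S i).card = multigraphDegree H S i := rfl

lemma multigraphDegree_le {dv dc : ℕ} (hH : IsRegularCode H dv dc) (i : V) :
    multigraphDegree H S i ≤ dv := by
  rw [← hH.1 i]
  exact Finset.card_le_card fun j hj => by
    simp only [Finset.mem_filter, Finset.mem_univ, true_and] at hj ⊢
    exact hj.1

lemma exists_other_end (z : State H S) : ∃ v ∈ S, v ≠ z.1.1 ∧ H z.1.2 v = 1 := by
  obtain ⟨⟨i, j⟩, hi, hj, h2⟩ := z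
  have hone : 1 < (S.filter fun a => H j a = 1).card := by
    change 1 < subDegree H S j
    exact h2.symm ▸ one_lt_two
  obtain ⟨v, hv, hvi⟩ := Finset.exists_mem_ne hone i
  rw [Finset.mem_filter] at hv
  exact ⟨v, hv.1, hvi, hv.2⟩

lemma eq_of_ne_of_subDegree_eq_two {j : C} (h2 : subDegree H S j = 2) {u v w : V}
    (hu : u ∈ S) (hv : v ∈ S) (hw : w ∈ S) (hju : H j u = 1) (hjv : H j v = 1) (hjw : H j w = 1)
    (huv : u ≠ v) (huw : u ≠ w) : v = w := by
  by_contra hvw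
  have hsub : ({u, v, w} : Finset V) ⊆ S.filter fun i => H j i = 1 := by
    intro i hi
    simp only [Finset.mem_insert, Finset.mem_singleton] at hi
    rw [Finset.mem_filter]
    rcases hi with rfl | rfl | rfl
    exacts [⟨hu, hju⟩, ⟨hv, hjv⟩, ⟨hw, hjw⟩]
  have := Finset.card_le_card hsub
  rw [Finset.card_eq_three.2 ⟨u, v, w, huv, huw, hvw, rfl⟩] at this
  rw [subDegree] at h2
  omega

lemma Arc.tail_eq {z z' : State H S} (h : Arc H S z z') {v : V} (hv : v ∈ S) (hvz : v ≠ z.1.1)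
    (hzv : H z.1.2 v = 1) : z'.1.1 = v :=
  eq_of_ne_of_subDegree_eq_two z.2.2.2 z.2.1 z'.2.1 hv z.2.2.1 h.1 hzv h.2.1.symm hvz.symm

/-- A state pointing to `v` has one successor less than there are edges at `v`. -/
lemma card_succ_add_one (z : State H S) {v : V} (hv : v ∈ S) (hvz : v ≠ z.1.1)
    (hzv : H z.1.2 v = 1) :
    (Finset.univ.filter fun z' => Arc H S z z').card + 1 = multigraphDegree H S v := by
  have hmem : z.1.2 ∈ edgesAt H S v := by
    simp only [Finset.mem_filter, Finset.mem_univ, true_and]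
    exact ⟨hzv, z.2.2.2⟩
  have himage : (Finset.univ.filter fun z' => Arc H S z z').image (fun z' => z'.1.2) =
      (edgesAt H S v).erase z.1.2 := by
    ext j
    simp only [Finset.mem_image, Finset.mem_filter, Finset.mem_univ, true_and, Finset.mem_erase]
    constructor
    · rintro ⟨z', h, rfl⟩
      have := h.tail_eq hv hvz hzv
      exact ⟨h.2.2, this ▸ z'.2.2.1, z'.2.2.2⟩
    · rintro ⟨hj, hjv, hj2⟩
      exact ⟨⟨(v, j), hv, hjv, hj2⟩, ⟨hzv, hvz, hj⟩, rfl⟩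
  rw [← card_edgesAt, ← Finset.card_erase_add_one hmem, ← himage, Finset.card_image_of_injOn]
  intro a ha b hb hab
  have ha' := Arc.tail_eq (Finset.mem_filter.1 ha).2 hv hvz hzv
  have hb' := Arc.tail_eq (Finset.mem_filter.1 hb).2 hv hvz hzv
  exact Subtype.ext (Prod.ext (ha'.trans hb'.symm) hab)

/-- A predecessor is determined by its edge, which lies at the tail of `z'` and differs from the
edge of `z'`. -/
lemma card_pred_add_one_le (z' : State H S) :
    (Finset.univ.filter fun z => Arc H S z z').card + 1 ≤ multigraphDegree H S z'.1.1 := by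
  have hmem : z'.1.2 ∈ edgesAt H S z'.1.1 := by
    simp only [Finset.mem_filter, Finset.mem_univ, true_and]
    exact z'.2.2
  rw [← card_edgesAt, ← Finset.card_erase_add_one hmem, add_le_add_iff_right]
  refine Finset.card_le_card_of_injOn (fun z => z.1.2) (fun z hz => ?_) fun a ha b hb hab => ?_
  · have h := (Finset.mem_filter.1 hz).2
    simp only [Finset.coe_erase, Set.mem_sdiff, Set.mem_singleton_iff, Finset.mem_coe,
      Finset.mem_filter, Finset.mem_univ, true_and]
    exact ⟨⟨h.1, z.2.2.2⟩, h.2.2.symm⟩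
  · have ha' := (Finset.mem_filter.1 ha).2
    have hb' := (Finset.mem_filter.1 hb).2
    have hab : a.1.2 = b.1.2 := hab
    refine Subtype.ext (Prod.ext ?_ hab)
    exact eq_of_ne_of_subDegree_eq_two a.2.2.2 z'.2.1 a.2.1 b.2.1 ha'.1 a.2.2.1
      (hab ▸ b.2.2.1) ha'.2.1 hb'.2.1

/-- A property of variable nodes that spreads along the edges of the multigraph holds on all of a
trapping set if it holds somewhere. -/
lemma IsElementaryTrappingSet.forall_of_closed (hS : IsElementaryTrappingSet H S) {Q : V → Prop}
    {i₀ : V} (hi₀ : i₀ ∈ S) (h₀ : Q i₀)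
    (hQ : ∀ z : State H S, Q z.1.1 → ∀ i ∈ S, H z.1.2 i = 1 → i ≠ z.1.1 → Q i) :
    ∀ i ∈ S, Q i := by
  -- Extending `Q` to check nodes lets it be carried along walks of the Tanner graph.
  let T : V ⊕ C → Prop := Sum.elim Q fun j => ∀ i ∈ S, H j i = 1 → Q i
  have hstep : ∀ a b : subgraphNodes H S,
      ((tannerGraph H).induce (subgraphNodes H S)).Adj a b → T a → T b := by
    rintro ⟨a | a, ha⟩ ⟨b | b, hb⟩ hab hT
    · exact hab.elim
    · intro i hi hbi
      have hba : H b a = 1 := hab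
      have haS : a ∈ S := by simpa [subgraphNodes] using ha
      rcases eq_or_ne i a with rfl | hia
      · exact hT
      have hone : 1 < subDegree H S b := Finset.one_lt_card.2
        ⟨i, Finset.mem_filter.2 ⟨hi, hbi⟩, a, Finset.mem_filter.2 ⟨haS, hba⟩, hia⟩
      have h2 : subDegree H S b = 2 := by
        have := hS.elementary b ⟨a, haS, hba⟩
        omega
      exact hQ ⟨(a, b), haS, hba, h2⟩ hT i hi hbi hia
    · have hbS : b ∈ S := by simpa [subgraphNodes] using hb
      exact hT b hbS hab
    · exact hab.elim
  have hwalk : ∀ (a b : subgraphNodes H S)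
      (_ : ((tannerGraph H).induce (subgraphNodes H S)).Walk a b), T a → T b := by
    intro a b p
    induction p with
    | nil => exact id
    | cons hadj _ ih => exact fun hT => ih (hstep _ _ hadj hT)
  intro i hi
  obtain ⟨p⟩ := hS.connected.preconnected ⟨Sum.inl i₀, Or.inl ⟨i₀, hi₀, rfl⟩⟩
    ⟨Sum.inl i, Or.inl ⟨i, hi, rfl⟩⟩
  exact hwalk _ _ p h₀

lemma IsElementaryTrappingSet.nonempty_state (hS : IsElementaryTrappingSet H S) :
    Nonempty (State H S) := by
  by_contra hne
  obtain ⟨i, hi, i', hi', hne'⟩ := Finset.one_lt_card.1 (show 1 < S.card from hS.two_le_card)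
  -- Without states, being equal to `i` spreads vacuously, contradicting `2 ≤ S.card`.
  exact hne' (hS.forall_of_closed (Q := fun a => i = a) hi rfl
    (fun z => (hne ⟨z⟩).elim) i' hi')

lemma IsElementaryTrappingSet.one_le_trappingRadius (hS : IsElementaryTrappingSet H S) :
    1 ≤ trappingRadius H S := by
  have := hS.nonempty_state
  rw [trappingRadius, stateMatrix_eq_relMatrix]
  refine one_le_spectralRadius_relMatrix _ fun z => ?_
  obtain ⟨v, hv, hvz, hzv⟩ := exists_other_end z
  have hcard := card_succ_add_one z hv hvz hzv
  have := hS.leafless v hv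
  obtain ⟨z', hz'⟩ := Finset.card_pos.1
    (by omega : 0 < (Finset.univ.filter fun z' => Arc H S z z').card)
  exact ⟨z', (Finset.mem_filter.1 hz').2⟩

/-- Let `P` be a set of states that is closed under successors and predecessors. If a state of `P`
points to a vertex with at least three edges, then `P` contains all states leaving that vertex. -/
lemma mem_of_closed {P : Finset (State H S)}
    (hP : ∀ z z', Arc H S z z' → (z ∈ P ↔ z' ∈ P)) {z : State H S} (hz : z ∈ P) {v : V}
    (hv : v ∈ S) (hvz : v ≠ z.1.1) (hzv : H z.1.2 v = 1) (hdeg : 3 ≤ multigraphDegree H S v)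
    (z' : State H S) (hz' : z'.1.1 = v) : z' ∈ P := by
  by_cases hj : z'.1.2 = z.1.2
  · have hcard := card_succ_add_one z hv hvz hzv
    obtain ⟨a, ha, b, hb, hab⟩ := Finset.one_lt_card.1
      (by omega : 1 < (Finset.univ.filter fun z' => Arc H S z z').card)
    replace ha := (Finset.mem_filter.1 ha).2
    replace hb := (Finset.mem_filter.1 hb).2
    have hav := ha.tail_eq hv hvz hzv
    have hbv := hb.tail_eq hv hvz hzv
    have hjab : b.1.2 ≠ a.1.2 := fun h => hab (Subtype.ext (Prod.ext (hav.trans hbv.symm) h.symm))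
    obtain ⟨w, hw, hwa, haw⟩ := exists_other_end a
    -- Here `z'` is the reversal of `z`, which is not a successor of `z`. The reversal `y` of `a`
    -- enters `v` and precedes both `b` and `z'`, so membership passes from `z` to `b`, back to `y`,
    -- and on to `z'`.
    let y : State H S := ⟨(w, a.1.2), hw, haw, a.2.2.2⟩
    have hav1 : H a.1.2 v = 1 := hav ▸ a.2.2.1
    have hvw : v ≠ w := hav ▸ hwa.symm
    have hyb : Arc H S y b := ⟨hbv.symm ▸ hav1, hbv.symm ▸ hvw, hjab⟩
    have hyz : Arc H S y z' := ⟨hz'.symm ▸ hav1, hz'.symm ▸ hvw, hj.symm ▸ ha.2.2.symm⟩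
    exact (hP y z' hyz).1 ((hP y b hyb).2 ((hP z b hb).1 hz))
  · exact (hP z z' ⟨hz'.symm ▸ hzv, hz'.symm ▸ hvz, hj⟩).1 hz

lemma IsElementaryTrappingSet.trappingRadius_lt {dv dc : ℕ} (hS : IsElementaryTrappingSet H S)
    (hH : IsRegularCode H dv dc) (hdv : 3 ≤ dv) : trappingRadius H S < (dv : ℝ) - 1 := by
  have := hS.nonempty_state
  by_contra! hr
  rw [trappingRadius, stateMatrix_eq_relMatrix] at hr
  have hcast : ((dv - 1 : ℕ) : ℝ) = (dv : ℝ) - 1 := by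
    rw [Nat.cast_sub (by omega), Nat.cast_one]
  obtain ⟨P, ⟨z₀, hz₀⟩, hcard, hP⟩ := exists_closed_of_le_spectralRadius (Arc H S) (d := dv - 1)
    (fun z => by
      obtain ⟨v, hv, hvz, hzv⟩ := exists_other_end z
      have := card_succ_add_one z hv hvz hzv
      have := multigraphDegree_le (S := S) hH v
      omega)
    (fun z => by
      have := card_pred_add_one_le z
      have := multigraphDegree_le (S := S) hH z.1.1
      omega)
    (hcast.trans_le hr)
  have hspread : ∀ z ∈ P, ∀ v ∈ S, v ≠ z.1.1 → H z.1.2 v = 1 →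
      multigraphDegree H S v = dv ∧ ∀ z' : State H S, z'.1.1 = v → z' ∈ P := by
    intro z hz v hv hvz hzv
    have hdeg : multigraphDegree H S v = dv := by
      have := card_succ_add_one z hv hvz hzv
      have := hcard z hz
      omega
    exact ⟨hdeg, mem_of_closed hP hz hv hvz hzv (hdeg ▸ hdv)⟩
  obtain ⟨v₀, hv₀, hvz₀, hzv₀⟩ := exists_other_end z₀
  -- The property that spreads is the conjunction: full degree `dv`, and all departing states in
  -- `P`.
  have hall := hS.forall_of_closed hv₀ (hspread z₀ hz₀ v₀ hv₀ hvz₀ hzv₀)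
    fun z hz i hi hzi hiz => hspread z (hz.2 z rfl) i hi hiz hzi
  obtain ⟨j, hj⟩ := Finset.card_pos.1 hS.exists_degree_one
  have hj1 : subDegree H S j = 1 := (Finset.mem_filter.1 hj).2
  obtain ⟨i, hi⟩ := Finset.card_pos.1 (show 0 < (S.filter fun i => H j i = 1).card by
    rw [subDegree] at hj1
    omega)
  obtain ⟨hiS, hji⟩ := Finset.mem_filter.1 hi
  -- The degree-one check `j` uses up one of the `dv` checks at `i` without being an edge of the
  -- multigraph.
  have hlt : multigraphDegree H S i < dv := by
    rw [← hH.1 i]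
    refine Finset.card_lt_card (Finset.ssubset_iff_subset_ne.2 ⟨fun j' hj' => ?_, fun heq => ?_⟩)
    · simp only [Finset.mem_filter, Finset.mem_univ, true_and] at hj' ⊢
      exact hj'.1
    · have : j ∈ Finset.univ.filter fun j : C => H j i = 1 := by simpa using hji
      rw [← heq] at this
      have := (Finset.mem_filter.1 this).2.2
      omega
  exact hlt.ne (hall i hiS).1

end TrappingSets

end LDPC

theorem mainTheorem3 {V C : Type*} [Fintype V] [Fintype C] [DecidableEq V] [DecidableEq C]
    (H : Matrix C V (ZMod 2)) (dv dc : ℕ) (hH : LDPC.IsRegularCode H dv dc) (hdv : 3 ≤ dv)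
    (γ : ℝ) (hγ : LDPC.decodingThreshold dv dc (LDPC.codeRate H) < (γ : EReal)) :
    (∀ r : ℝ, 1 ≤ r → r < (dv : ℝ) - 1 →
      ∃ K : ℝ, 0 < K ∧ ∃ L : ℕ, ∀ l : ℕ, L ≤ l →
        K * r ^ l < LDPC.checkMean dv dc (LDPC.channelMean (LDPC.codeRate H) γ) l) ∧
    ∀ S : Finset V, LDPC.IsElementaryTrappingSet H S →
      (1 ≤ LDPC.trappingRadius H S ∧ LDPC.trappingRadius H S < (dv : ℝ) - 1) ∧
      (∃ K : ℝ, 0 < K ∧ ∃ L : ℕ, ∀ l : ℕ, L ≤ l →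
        K * LDPC.trappingRadius H S ^ l <
          LDPC.checkMean dv dc (LDPC.channelMean (LDPC.codeRate H) γ) l) ∧
      Tendsto (fun l : ℕ =>
        LDPC.checkMean dv dc (LDPC.channelMean (LDPC.codeRate H) γ) l /
          LDPC.trappingRadius H S ^ l) atTop atTop := by
  obtain ⟨hdc, hm, hlim⟩ := LDPC.tendsto_checkMean_of_threshold_lt (by omega : 1 ≤ dv)
    (LDPC.codeRate_nonneg H) hγ
  have growth : ∀ r : ℝ, 1 ≤ r → r < (dv : ℝ) - 1 →
      ∃ K : ℝ, 0 < K ∧ ∃ L : ℕ, ∀ l : ℕ, L ≤ l →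
        K * r ^ l < LDPC.checkMean dv dc (LDPC.channelMean (LDPC.codeRate H) γ) l :=
    fun r h1 h2 =>
      LDPC.exists_mul_pow_lt_checkMean (by omega) hdc hm hlim (zero_lt_one.trans_le h1) h2
  refine ⟨growth, fun S hS => ?_⟩
  have h1 := hS.one_le_trappingRadius
  have h2 := hS.trappingRadius_lt hH hdv
  refine ⟨⟨h1, h2⟩, growth _ h1 h2, ?_⟩
  obtain ⟨s, hrs, hsd⟩ := exists_between h2
  obtain ⟨K, hK, L, hL⟩ := growth s (h1.trans hrs.le) hsd
  have hr0 : 0 < LDPC.trappingRadius H S := zero_lt_one.trans_le h1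
  refine tendsto_atTop_mono' atTop ?_
    ((tendsto_pow_atTop_atTop_of_one_lt ((one_lt_div hr0).2 hrs)).const_mul_atTop hK)
  filter_upwards [eventually_ge_atTop L] with l hl
  rw [div_pow, ← mul_div_assoc]
  exact div_le_div_of_nonneg_right (hL l hl).le (by positivity)
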